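/- Let $F$ be a non-archimedean local field of residual characteristic $\neq 2$, with ring of integers $R$, uniformizer $\pi$, residue field of cardinality $q$, and absolute value normalized by $|\pi|=q^{-1}$. Let $\psi:F\to\mathbb{C}^\times$ be a (continuous, unitary) additive character that is trivial on $R$ but not on $\pi^{-1}R$. Let $dx$ be the Haar measure on $F$ giving $R$ volume $1$, and $d^\times\alpha$ the Haar measure on $F^\times$ giving $R^\times$ volume $1$. Let $J$ be the $5\times5$ matrix with ones on the antidiagonal and zeros elsewhere, $G=\{g\in SL(5,F): {}^tgJg=J\}$, and let $K$ be the subgroup of elements of $G$ with entries in $R$. Let $S=\{x\in F^5: 2x_1x_5+2x_2x_4+x_3^2=1\}$. Put $v_0={}^t(0,0,1,0,0)$, $v_1={}^t(1/2,0,0,0,1)$, $a_\alpha=\mathrm{diag}(\alpha,1,1,1,\alpha^{-1})$ for $\alpha\in F^\times$, $$n(x_1,x_2,x_3)=\begin{pmatrix}1&-x_3&-x_2&-x_1&-x_1x_3-\frac12x_2^2\\0&1&0&0&x_1\\0&0&1&0&x_2\\0&0&0&1&x_3\\0&0&0&0&1\end{pmatrix},\qquad \gamma_0=\begin{pmatrix}\frac12&0&\frac12&0&-\frac14\\0&1&0&0&0\\-1&0&0&0&-\frac12\\0&0&0&1&0\\-1&0&1&0&\frac12\end{pmatrix},$$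 so that $\gamma_0\in G$ and $\gamma_0v_0=v_1$. For a function $\phi$ on $S$ and $\alpha\in F^\times$ define the orbital integral (in the split case) $$\Psi(\alpha,\phi)=\int_{F^3}\phi\bigl(n(x_1,x_2,x_3)\,a_\alpha\gamma_0v_0\bigr)\,\psi(x_2)\,dx_1\,dx_2\,dx_3 .$$ For $r\ge0$ let $\Phi_r=\sum_{i=0}^r\phi_i$, where $\phi_i$ is the characteristic function of the $K$-orbit of $a_{\pi^i}v_1$. **Proposition 3.5.** Let $r\ge 1$ be an integer and let $\chi:F^\times\to\mathbb{C}^\times$ be a continuous character. Then $\Phi_r$ is the characteristic function of $\{x\in S: |x_i|\le q^r \text{ for } 1\le i\le 5\}$; the integrals defining $\Psi(\alpha,\Phi_r)$, for every $\alpha\in F^\times$, and $\int_{F^\times}\Psi(\alpha,\Phi_r)\chi(\alpha)\,d^\times\alpha$ converge absolutely; and $$\int_{F^\times}\Psi(\alpha,\Phi_r)\,\chi(\alpha)\,d^\times\alpha=\begin{cases} qX^{1-r}+X^{-r}, & \text{if } \chi \text{ is unramified (trivial on } R^\times), \text{ where } X=\chi(\pi)^{-1},\\ 0, & \text{if } \chi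 \text{ is ramified.}\end{cases}$$ -/

import Mathlib

open MeasureTheory
open scoped Matrix

noncomputable section

namespace OrbitalIntegral

/-! ### The field

A non-archimedean local field is a locally compact (equivalently: proper), nontrivially normed
field with an ultrametric norm. That the norm is the normalized absolute value is a hypothesis of
the theorem. -/

section LocalField

variable (F : Type*) [NontriviallyNormedField F] [IsUltrametricDist F]

/-- The ring of integers `R = {x : |x| ≤ 1}`. -/
abbrev R : ValuationSubring F := (NormedField.valuation (K := F)).valuationSubring

/-- The residue field of `R`. -/
abbrev Residue : Type _ := IsLocalRing.ResidueField (R F)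

/-- The cardinality `q` of the residue field. -/
def q : ℕ := Nat.card (Residue F)

variable {F}

/-- `ϖ` generates the maximal ideal of `R`. -/
def IsUniformizer (ϖ : Fˣ) : Prop :=
  ∃ p : R F, (p : F) = ϖ ∧ IsLocalRing.maximalIdeal (R F) = Ideal.span {p}

/-- The additive character `ψ` has conductor `R`: it is trivial on `R`, but not on `ϖ⁻¹ R`. -/
def HasConductorR (ψ : AddChar F Circle) (ϖ : Fˣ) : Prop :=
  (∀ x ∈ R F, ψ x = 1) ∧ ∃ x ∈ R F, ψ ((ϖ : F)⁻¹ * x) ≠ 1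

/-- A character of `Fˣ` is unramified if it is trivial on `Rˣ = {u : |u| = 1}`. -/
def IsUnramified (χ : Fˣ →* ℂˣ) : Prop := ∀ u : Fˣ, ‖(u : F)‖ = 1 → χ u = 1

end LocalField

/-! ### The group `SO(3,2)` and the sphere `S`, in the split case -/

section Group

variable (F : Type*) [NontriviallyNormedField F] [IsUltrametricDist F]

/-- The matrix with ones on the antidiagonal and zeros elsewhere. -/
def J₅ : Matrix (Fin 5) (Fin 5) F :=
  !![0, 0, 0, 0, 1;
     0, 0, 0, 1, 0;
     0, 0, 1, 0, 0;
     0, 1, 0, 0, 0;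
     1, 0, 0, 0, 0]

/-- `G = SO(3,2; F)`, where `J = J₅`. -/
def G : Set (Matrix (Fin 5) (Fin 5) F) := {g | g.det = 1 ∧ gᵀ * J₅ F * g = J₅ F}

/-- `K = SO(3,2; R)`. -/
def K : Set (Matrix (Fin 5) (Fin 5) F) := {g | g ∈ G F ∧ ∀ i j, g i j ∈ R F}

/-- The sphere `S = {v : ᵗv J v = 1}`. -/
def S : Set (Fin 5 → F) := {v | v ⬝ᵥ (J₅ F *ᵥ v) = 1}

/-- The base point `v₀` of `S`, whose stabilizer in `G` is `C = SO(2,2; F)`. -/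
def v₀ : Fin 5 → F := ![0, 0, 1, 0, 0]

/-- The point `v₁` of `S`; it is equal to `γ₀ v₀`. -/
def v₁ : Fin 5 → F := ![1 / 2, 0, 0, 0, 1]

/-- The element `γ₀` of `G`. -/
def γ₀ : Matrix (Fin 5) (Fin 5) F :=
  !![1 / 2, 0, 1 / 2, 0, -(1 / 4);
     0,     1, 0,     0, 0;
     -1,    0, 0,     0, -(1 / 2);
     0,     0, 0,     1, 0;
     -1,    0, 1,     0, 1 / 2]

variable {F}

/-- The element `a_α = diag(α, 1, 1, 1, α⁻¹)` of the torus `A`. -/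
def a (α : Fˣ) : Matrix (Fin 5) (Fin 5) F :=
  Matrix.diagonal ![(α : F), 1, 1, 1, (α : F)⁻¹]

/-- The element `n(x₁, x₂, x₃)` of the unipotent group `N ≃ F³`. -/
def n (x₁ x₂ x₃ : F) : Matrix (Fin 5) (Fin 5) F :=
  !![1, -x₃, -x₂, -x₁, -x₁ * x₃ - x₂ ^ 2 / 2;
     0, 1,   0,   0,   x₁;
     0, 0,   1,   0,   x₂;
     0, 0,   0,   1,   x₃;
     0, 0,   0,   0,   1]

/-- The `K`-orbit of `d_i v₁` where `d_i = diag(ϖ^i, 1, 1, 1, ϖ^(-i))`. -/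
def orbit (ϖ : Fˣ) (i : ℕ) : Set (Fin 5 → F) :=
  {v | ∃ k ∈ K F, v = k *ᵥ (a (ϖ ^ i) *ᵥ v₁ F)}

/-- `Φ_r = φ_0 + ⋯ + φ_r`, where `φ_i` is the characteristic function of the orbit `K d_i v₁`. -/
def Φ (ϖ : Fˣ) (r : ℕ) (v : Fin 5 → F) : ℂ :=
  ∑ i ∈ Finset.range (r + 1), (orbit ϖ i).indicator (fun _ => (1 : ℂ)) v

end Group

/-! ### The orbital integral and its Mellin transform -/

section Integral

variable {F : Type*} [NontriviallyNormedField F]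

/-- The integrand `φ(n a_α γ₀ v₀) ψ_N(n)` of the orbital integral, with `n = n(x₁, x₂, x₃)` and
`ψ_N(n) = ψ(x₂)`. -/
def orbitalIntegrand (ψ : AddChar F Circle) (φ : (Fin 5 → F) → ℂ) (α : Fˣ) (x : F × F × F) : ℂ :=
  φ (n x.1 x.2.1 x.2.2 *ᵥ (a α *ᵥ (γ₀ F *ᵥ v₀ F))) * (ψ x.2.1 : ℂ)

variable [MeasurableSpace F]

/-- The orbital integral `Ψ(α, φ) = ∫_N φ(n a_α γ₀ v₀) ψ_N(n) dn`, where `dn = dx₁ dx₂ dx₃`. -/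
def Ψ (μ : Measure F) (ψ : AddChar F Circle) (φ : (Fin 5 → F) → ℂ) (α : Fˣ) : ℂ :=
  ∫ x, orbitalIntegrand ψ φ α x ∂(μ.prod (μ.prod μ))

end Integral

end OrbitalIntegral

end

/-!
`K` acts on `S` by isometries of the sup norm, and every point of `S` of norm `|ϖ|⁻ⁱ` lies in the
orbit of `a_{ϖⁱ} v₁`, so `Φ_r` is the indicator function of a ball in `S`. Hence `Ψ(α, Φ_r)` is the
integral of `ψ(x₂)` over the set where `|x₁|, |x₂|, |x₃|` and `|α² - (2 x₁ x₃ + x₂²)|` are at most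
`A = |ϖ|⁻ʳ |α|`, and it vanishes for `A < 1` because of the last coordinate `α⁻¹`. For `A > 1`,
unipotent maps that move `x₂` and preserve `2 x₁ x₃ + x₂²` show that the part `|x₁| = A` contributes
nothing. On the part `|x₁| < A`, also `|x₂| < A`, so that for `A ≥ |ϖ|⁻²` a translation of `x₂` by
an element of `ϖ⁻¹ R` preserves the domain and the integral is again zero. There remain `A = 1` and
`A = |ϖ|⁻¹`, where the integrals are the volumes `1` and `q`. Thus `Ψ(·, Φ_r)` is `1` on `ϖʳ Rˣ`,
`q` on `ϖʳ⁻¹ Rˣ` and `0` elsewhere, and `χ` is integrated over these two cosets.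
-/

namespace OrbitalIntegral

section Ultrametric

variable {E : Type*} [SeminormedAddGroup E] [IsUltrametricDist E] {x y : E} {c : ℝ}

theorem norm_add_le_of_norm_le (hx : ‖x‖ ≤ c) (hy : ‖y‖ ≤ c) : ‖x + y‖ ≤ c :=
  (IsUltrametricDist.norm_add_le_max x y).trans (max_le hx hy)

theorem norm_sub_le_of_norm_le (hx : ‖x‖ ≤ c) (hy : ‖y‖ ≤ c) : ‖x - y‖ ≤ c := by
  rw [sub_eq_add_neg]
  exact norm_add_le_of_norm_le hx (by rwa [norm_neg])

theorem norm_add_lt_of_norm_lt (hx : ‖x‖ < c) (hy : ‖y‖ < c) : ‖x + y‖ < c :=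
  (IsUltrametricDist.norm_add_le_max x y).trans_lt (max_lt hx hy)

theorem norm_sub_lt_of_norm_lt (hx : ‖x‖ < c) (hy : ‖y‖ < c) : ‖x - y‖ < c := by
  rw [sub_eq_add_neg]
  exact norm_add_lt_of_norm_lt hx (by rwa [norm_neg])

end Ultrametric

theorem exists_norm_apply_eq {ι E : Type*} [Fintype ι] [Nonempty ι] [SeminormedAddGroup E]
    (v : ι → E) : ∃ i, ‖v i‖ = ‖v‖ := by
  obtain ⟨i, hi⟩ := Finite.exists_max fun i => ‖v i‖
  exact ⟨i, (norm_le_pi_norm v i).antisymm ((pi_norm_le_iff_of_nonempty v).2 hi)⟩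

section RingOfIntegers

variable {F : Type*} [NontriviallyNormedField F] [IsUltrametricDist F] {x y : F}

theorem mem_R_iff : x ∈ R F ↔ ‖x‖ ≤ 1 := by
  rw [Valuation.mem_valuationSubring_iff, ← NNReal.coe_le_coe]
  rfl

theorem mem_maximalIdeal_iff (x : R F) :
    x ∈ IsLocalRing.maximalIdeal (R F) ↔ ‖(x : F)‖ < 1 := by
  rw [← NNReal.coe_one, ← coe_nnnorm, NNReal.coe_lt_coe]
  exact (ValuationSubring.valuation_lt_one_iff (R F) x).trans
    (Valuation.isEquiv_valuation_valuationSubring _).lt_one_iff_lt_one.symm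

theorem norm_two (h_two : (2 : Residue F) ≠ 0) : ‖(2 : F)‖ = 1 := by
  refine le_antisymm (mod_cast IsUltrametricDist.norm_natCast_le_one F 2)
    (not_lt.1 fun hlt => h_two ?_)
  rw [← map_ofNat (IsLocalRing.residue (R F)) 2, IsLocalRing.residue_eq_zero_iff]
  exact (mem_maximalIdeal_iff 2).2 hlt

namespace IsUniformizer

variable {ϖ : Fˣ}

theorem norm_lt_one (hϖ : IsUniformizer ϖ) : ‖(ϖ : F)‖ < 1 := by
  obtain ⟨p, hp, hm⟩ := hϖ
  rw [← hp, ← mem_maximalIdeal_iff, hm]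
  exact Ideal.mem_span_singleton_self p

theorem norm_le_of_norm_lt_one (hϖ : IsUniformizer ϖ) (hx : ‖x‖ < 1) : ‖x‖ ≤ ‖(ϖ : F)‖ := by
  obtain ⟨p, hp, hm⟩ := hϖ
  obtain ⟨c, hc⟩ : p ∣ ⟨x, mem_R_iff.2 hx.le⟩ := by
    rw [← Ideal.mem_span_singleton, ← hm]
    exact (mem_maximalIdeal_iff _).2 hx
  rw [show x = ϖ * c from hp ▸ congrArg Subtype.val hc, norm_mul]
  exact mul_le_of_le_one_right (norm_nonneg _) (mem_R_iff.1 c.2)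

theorem norm_le_mul_of_norm_lt (hϖ : IsUniformizer ϖ) (h : ‖x‖ < ‖y‖) :
    ‖x‖ ≤ ‖(ϖ : F)‖ * ‖y‖ := by
  have hy : 0 < ‖y‖ := (norm_nonneg x).trans_lt h
  rw [← div_le_iff₀ hy, ← norm_div]
  exact hϖ.norm_le_of_norm_lt_one (by rwa [norm_div, div_lt_one hy])

theorem one_lt_inv_norm (hϖ : IsUniformizer ϖ) : 1 < ‖(ϖ : F)‖⁻¹ :=
  (one_lt_inv₀ (norm_pos_iff.2 ϖ.ne_zero)).2 hϖ.norm_lt_one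

theorem exists_norm_eq_zpow (hϖ : IsUniformizer ϖ) (hx : x ≠ 0) :
    ∃ k : ℤ, ‖x‖ = ‖(ϖ : F)‖ ^ k := by
  obtain ⟨k, hlt, hle⟩ := exists_mem_Ioc_zpow (norm_pos_iff.2 hx) hϖ.one_lt_inv_norm
  have hϖ0 : ‖(ϖ : F)‖ ≠ 0 := norm_ne_zero_iff.2 ϖ.ne_zero
  rw [inv_zpow', ← norm_zpow] at hlt hle
  refine ⟨-(k + 1), (norm_zpow (ϖ : F) _).symm ▸ hle.antisymm (not_lt.1 fun h => hlt.not_ge ?_)⟩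
  calc ‖x‖ ≤ ‖(ϖ : F)‖ * ‖(ϖ : F) ^ (-(k + 1))‖ := hϖ.norm_le_mul_of_norm_lt h
    _ = ‖(ϖ : F) ^ (-k)‖ := by
      rw [norm_zpow, norm_zpow, ← zpow_one_add₀ hϖ0]
      congr 1
      ring

theorem norm_mul_lt_one_iff (hϖ : IsUniformizer ϖ) : ‖(ϖ : F) * x‖ < 1 ↔ ‖x‖ ≤ 1 := by
  have hϖ0 : 0 < ‖(ϖ : F)‖ := norm_pos_iff.2 ϖ.ne_zero
  constructor
  · intro h
    have := hϖ.norm_le_of_norm_lt_one h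
    rwa [norm_mul, mul_le_iff_le_one_right hϖ0] at this
  · intro h
    rw [norm_mul]
    exact (mul_le_of_le_one_right hϖ0.le h).trans_lt hϖ.norm_lt_one

theorem norm_lt_inv_norm_iff (hϖ : IsUniformizer ϖ) : ‖x‖ < ‖(ϖ : F)‖⁻¹ ↔ ‖x‖ ≤ 1 := by
  rw [← hϖ.norm_mul_lt_one_iff, norm_mul, ← mul_one ‖(ϖ : F)‖⁻¹,
    lt_inv_mul_iff₀ (norm_pos_iff.2 ϖ.ne_zero)]

-- `x ↦ ϖ⁻¹ x` maps `R` onto the ball of radius `|ϖ|⁻¹`, and the maximal ideal, of index `q`,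
-- onto `R`.
theorem measure_closedBall_inv [MeasurableSpace F] [BorelSpace F] [Finite (Residue F)]
    (hϖ : IsUniformizer ϖ) (μ : Measure F) [μ.IsAddHaarMeasure]
    (hμ : μ (Metric.closedBall 0 1) = 1) : μ (Metric.closedBall 0 ‖(ϖ : F)‖⁻¹) = q F := by
  let m : AddSubgroup (R F) := (IsLocalRing.maximalIdeal (R F)).toAddSubgroup
  have hindex : m.index = q F := rfl
  have : m.FiniteIndex := ⟨by rw [hindex]; exact Nat.card_pos.ne'⟩
  have hR : MeasurableSet (R F : Set F) := by
    rw [show (R F : Set F) = Metric.closedBall 0 1 from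
      Set.ext fun x => mem_R_iff.trans mem_closedBall_zero_iff.symm]
    exact measurableSet_closedBall
  have hm : MeasurableSet (m : Set (R F)) := by
    rw [show (m : Set (R F)) = (↑) ⁻¹' Metric.ball (0 : F) 1 from
      Set.ext fun x => (mem_maximalIdeal_iff x).trans mem_ball_zero_iff.symm]
    exact measurable_subtype_coe measurableSet_ball
  let f : R F →+ F := (AddMonoidHom.mulLeft (ϖ : F)⁻¹).comp (R F).subtype.toAddMonoidHom
  have hf : MeasurableEmbedding f :=
    (Homeomorph.mulLeft₀ (ϖ : F)⁻¹ (inv_ne_zero ϖ.ne_zero)).measurableEmbedding.comp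
      (MeasurableEmbedding.subtype_coe hR)
  have mem_image (s : Set (R F)) (x : F) : x ∈ f '' s ↔ ∃ y ∈ s, (y : F) = ϖ * x :=
    exists_congr fun y => and_congr_right fun _ => inv_mul_eq_iff_eq_mul₀ ϖ.ne_zero
  have image_univ : f '' Set.univ = Metric.closedBall 0 ‖(ϖ : F)‖⁻¹ := by
    ext x
    rw [mem_image, mem_closedBall_zero_iff, ← mul_one ‖(ϖ : F)‖⁻¹,
      le_inv_mul_iff₀ (norm_pos_iff.2 ϖ.ne_zero), ← norm_mul, ← mem_R_iff]
    exact ⟨fun ⟨y, _, hy⟩ => hy ▸ y.2, fun h => ⟨⟨_, h⟩, trivial, rfl⟩⟩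
  have image_m : f '' m = Metric.closedBall 0 1 := by
    ext x
    rw [mem_image, mem_closedBall_zero_iff, ← hϖ.norm_mul_lt_one_iff]
    exact ⟨fun ⟨y, hm, hy⟩ => hy ▸ (mem_maximalIdeal_iff y).1 hm,
      fun h => ⟨⟨_, mem_R_iff.2 h.le⟩, (mem_maximalIdeal_iff _).2 h, rfl⟩⟩
  have := Measure.IsAddLeftInvariant.comap μ hf
  have key := m.index_mul_measure hm (μ.comap f)
  rwa [hf.comap_apply, hf.comap_apply, image_m, image_univ, hμ, mul_one, hindex, eq_comm] at key

end IsUniformizer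

end RingOfIntegers

section Group

variable {F : Type*} [NontriviallyNormedField F] {g h : Matrix (Fin 5) (Fin 5) F}
  {v : Fin 5 → F}

theorem J₅_mul_J₅ : J₅ F * J₅ F = 1 := by
  ext i j
  fin_cases i <;> fin_cases j <;> simp [J₅, Matrix.mul_apply, Fin.sum_univ_five]

theorem mul_mem_G (hg : g ∈ G F) (hh : h ∈ G F) : g * h ∈ G F := by
  refine ⟨by rw [Matrix.det_mul, hg.1, hh.1, one_mul], ?_⟩
  calc (g * h)ᵀ * J₅ F * (g * h) = hᵀ * (gᵀ * J₅ F * g) * h := by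
        simp only [Matrix.transpose_mul, Matrix.mul_assoc]
    _ = J₅ F := by rw [hg.2, hh.2]

theorem J₅_mul_transpose_mul_J₅_mul (hg : g ∈ G F) : J₅ F * gᵀ * J₅ F * g = 1 := by
  rw [Matrix.mul_assoc, Matrix.mul_assoc, ← Matrix.mul_assoc gᵀ, hg.2, J₅_mul_J₅]

theorem J₅_mem_G : J₅ F ∈ G F := by
  refine ⟨?_, ?_⟩
  · simp [J₅, Matrix.det_succ_row_zero, Fin.sum_univ_succ, Fin.succAbove]
    ring
  · rw [show (J₅ F)ᵀ = J₅ F by ext i j; fin_cases i <;> fin_cases j <;> rfl, J₅_mul_J₅, one_mul]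

theorem transpose_mem_G (hg : g ∈ G F) : gᵀ ∈ G F := by
  refine ⟨by rw [Matrix.det_transpose, hg.1], ?_⟩
  have h := mul_eq_one_comm.1 (J₅_mul_transpose_mul_J₅_mul hg)
  calc gᵀᵀ * J₅ F * gᵀ = g * (J₅ F * gᵀ * J₅ F) * J₅ F := by
        simp only [Matrix.transpose_transpose, Matrix.mul_assoc, J₅_mul_J₅, mul_one]
    _ = J₅ F := by rw [h, one_mul]

theorem n_mem_G (h2 : (2 : F) ≠ 0) (x y z : F) : n x y z ∈ G F := by
  constructor
  · rw [n, Matrix.det_of_isUpperTriangular]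
    · simp [Fin.prod_univ_five]
    · intro i j hij
      fin_cases i <;> fin_cases j <;> first | rfl | exact absurd hij (by decide)
  · ext i j
    fin_cases i <;> fin_cases j <;> simp [n, J₅, Matrix.mul_apply, Fin.sum_univ_five]
    field_simp
    ring

theorem a_mem_G (α : Fˣ) : a α ∈ G F := by
  constructor
  · simp [a, Matrix.det_diagonal, Fin.prod_univ_five]
  · ext i j
    fin_cases i <;> fin_cases j <;> simp [a, J₅, Matrix.mul_apply, Matrix.diagonal_apply]

/-- The Weyl group element that exchanges the coordinates `x₁ ↔ x₂` and `x₄ ↔ x₅`. It moves a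
dominant coordinate of a point of `S` to the first or the last place. -/
def weylSwap (F : Type*) [NontriviallyNormedField F] : Matrix (Fin 5) (Fin 5) F :=
  !![0, 1, 0, 0, 0;
     1, 0, 0, 0, 0;
     0, 0, 1, 0, 0;
     0, 0, 0, 0, 1;
     0, 0, 0, 1, 0]

theorem weylSwap_mem_G : weylSwap F ∈ G F := by
  constructor
  · simp [weylSwap, Matrix.det_succ_row_zero, Fin.sum_univ_succ, Fin.succAbove]
  · ext i j
    fin_cases i <;> fin_cases j <;> simp [weylSwap, J₅, Matrix.mul_apply, Fin.sum_univ_five]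

theorem J₅_mulVec (v : Fin 5 → F) : J₅ F *ᵥ v = ![v 4, v 3, v 2, v 1, v 0] := by
  ext i
  fin_cases i <;> simp [J₅, Matrix.mulVec, dotProduct, Fin.sum_univ_five]

theorem weylSwap_mulVec (v : Fin 5 → F) : weylSwap F *ᵥ v = ![v 1, v 0, v 2, v 4, v 3] := by
  ext i
  fin_cases i <;> simp [weylSwap, Matrix.mulVec, dotProduct, Fin.sum_univ_five]

theorem n_mulVec (x y z : F) (v : Fin 5 → F) :
    n x y z *ᵥ v = ![v 0 - z * v 1 - y * v 2 - x * v 3 + (-x * z - y ^ 2 / 2) * v 4,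
      v 1 + x * v 4, v 2 + y * v 4, v 3 + z * v 4, v 4] := by
  ext i
  fin_cases i <;>
    simp only [n, Matrix.mulVec, dotProduct, Fin.sum_univ_five, Matrix.of_apply, Matrix.cons_val',
      Matrix.cons_val, Matrix.cons_val_fin_one, Fin.zero_eta, Fin.mk_one, Fin.reduceFinMk] <;>
    ring

theorem a_mul_a (α β : Fˣ) : a α * a β = a (α * β) := by
  rw [a, a, a, Matrix.diagonal_mul_diagonal]
  congr 1
  ext i
  fin_cases i <;> simp [mul_comm]

theorem a_mulVec_v₁ (α : Fˣ) : a α *ᵥ v₁ F = ![(α : F) / 2, 0, 0, 0, (α : F)⁻¹] := by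
  ext i
  fin_cases i <;> simp [a, v₁, Matrix.mulVec_diagonal, div_eq_mul_inv]

theorem norm_a_mulVec_v₁ (h2 : ‖(2 : F)‖ = 1) {α : Fˣ} (hα : ‖(α : F)‖ ≤ 1) :
    ‖a α *ᵥ v₁ F‖ = ‖(α : F)‖⁻¹ := by
  have hα0 : 0 < ‖(α : F)‖ := norm_pos_iff.2 α.ne_zero
  rw [a_mulVec_v₁, ← norm_inv]
  refine le_antisymm ((pi_norm_le_iff_of_nonneg (norm_nonneg _)).2 fun j => ?_)
    (norm_le_pi_norm ![(α : F) / 2, 0, 0, 0, (α : F)⁻¹] 4)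
  have h_first : ‖(α : F)‖ ≤ ‖(α : F)‖⁻¹ := hα.trans ((one_le_inv₀ hα0).2 hα)
  fin_cases j <;> simp [h2, h_first]

theorem n_mulVec_a_mulVec_v₁ (α : Fˣ) (x y z : F) :
    n x y z *ᵥ (a α *ᵥ v₁ F) = ![(α : F) / 2 - (α : F)⁻¹ * (x * z + y ^ 2 / 2),
      (α : F)⁻¹ * x, (α : F)⁻¹ * y, (α : F)⁻¹ * z, (α : F)⁻¹] := by
  rw [a_mulVec_v₁, n_mulVec]
  ext i
  fin_cases i <;>
    simp only [Matrix.cons_val, Fin.zero_eta, Fin.mk_one, Fin.reduceFinMk] <;> ring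

theorem γ₀_mulVec_v₀ : γ₀ F *ᵥ v₀ F = v₁ F := by
  ext i
  fin_cases i <;> simp [γ₀, v₀, v₁, Matrix.mulVec, dotProduct, Fin.sum_univ_five]

theorem mem_S_iff : v ∈ S F ↔ 2 * v 0 * v 4 + 2 * v 1 * v 3 + v 2 ^ 2 = 1 := by
  have : v ⬝ᵥ (J₅ F *ᵥ v) = 2 * v 0 * v 4 + 2 * v 1 * v 3 + v 2 ^ 2 := by
    simp only [J₅_mulVec, dotProduct, Fin.sum_univ_five, Matrix.cons_val]
    ring
  rw [S, Set.mem_ofPred_eq, this]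

theorem mulVec_mem_S_iff (hg : g ∈ G F) : g *ᵥ v ∈ S F ↔ v ∈ S F := by
  have : (g *ᵥ v) ⬝ᵥ (J₅ F *ᵥ (g *ᵥ v)) = v ⬝ᵥ (J₅ F *ᵥ v) := by
    conv_rhs => rw [← hg.2, ← Matrix.mulVec_mulVec, ← Matrix.mulVec_mulVec,
      Matrix.dotProduct_mulVec v gᵀ, Matrix.vecMul_transpose]
  rw [S, Set.mem_ofPred_eq, Set.mem_ofPred_eq, this]

theorem v₁_mem_S (h2 : (2 : F) ≠ 0) : v₁ F ∈ S F := by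
  rw [mem_S_iff]
  simp [v₁, h2]

end Group

section IntegralGroup

variable {F : Type*} [NontriviallyNormedField F] [IsUltrametricDist F]
  {k k' : Matrix (Fin 5) (Fin 5) F} {v : Fin 5 → F} {ϖ : Fˣ} {i : ℕ}

theorem norm_dotProduct_le {m : Type*} [Fintype m] (v w : m → F) : ‖v ⬝ᵥ w‖ ≤ ‖v‖ * ‖w‖ :=
  IsUltrametricDist.norm_sum_le_of_forall_le_of_nonneg (by positivity) fun j _ => by
    rw [norm_mul]
    gcongr <;> exact norm_le_pi_norm _ j

theorem norm_mulVec_le {l m : Type*} [Fintype l] [Fintype m] {g : Matrix l m F}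
    (hg : ∀ i j, ‖g i j‖ ≤ 1) (v : m → F) : ‖g *ᵥ v‖ ≤ ‖v‖ :=
  (pi_norm_le_iff_of_nonneg (norm_nonneg v)).2 fun i =>
    (norm_dotProduct_le (g i) v).trans <| mul_le_of_le_one_left (norm_nonneg v) <|
      (pi_norm_le_iff_of_nonneg zero_le_one).2 (hg i)

theorem mul_mem_K (hk : k ∈ K F) (hk' : k' ∈ K F) : k * k' ∈ K F :=
  ⟨mul_mem_G hk.1 hk'.1, mul_mem (S := Subring _) (s := (R F).toSubring.matrix) hk.2 hk'.2⟩

theorem J₅_mem_K : J₅ F ∈ K F := by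
  refine ⟨J₅_mem_G, fun i j => ?_⟩
  fin_cases i <;> fin_cases j <;> first | exact one_mem _ | exact zero_mem _

theorem weylSwap_mem_K : weylSwap F ∈ K F := by
  refine ⟨weylSwap_mem_G, fun i j => ?_⟩
  fin_cases i <;> fin_cases j <;> first | exact one_mem _ | exact zero_mem _

theorem n_mem_K (h2 : ‖(2 : F)‖ = 1) {x y z : F} (hx : ‖x‖ ≤ 1) (hy : ‖y‖ ≤ 1) (hz : ‖z‖ ≤ 1) :
    n x y z ∈ K F := by
  refine ⟨n_mem_G (ne_zero_of_norm_ne_zero (h2.symm ▸ one_ne_zero)) x y z, ?_⟩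
  rw [← mem_R_iff] at hx hy hz
  have h_half : (2 : F)⁻¹ ∈ R F := mem_R_iff.2 (by rw [norm_inv, h2, inv_one])
  have h_corner : -x * z - y ^ 2 / 2 ∈ R F := by
    rw [div_eq_mul_inv]
    exact sub_mem (mul_mem (neg_mem hx) hz) (mul_mem (pow_mem hy 2) h_half)
  intro i j
  fin_cases i <;> fin_cases j <;>
    first | exact one_mem _ | exact zero_mem _ | assumption | exact neg_mem ‹_›

theorem a_mem_K {u : Fˣ} (hu : ‖(u : F)‖ = 1) : a u ∈ K F := by
  have h : (u : F) ∈ R F := mem_R_iff.2 hu.le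
  have h_inv : (u : F)⁻¹ ∈ R F := mem_R_iff.2 (by rw [norm_inv, hu, inv_one])
  refine ⟨a_mem_G u, fun i j => ?_⟩
  rw [a, Matrix.diagonal_apply]
  split_ifs
  · fin_cases i <;> first | exact one_mem _ | assumption
  · exact zero_mem _

theorem exists_mem_K_mul_eq_one (hk : k ∈ K F) : ∃ k' ∈ K F, k' * k = 1 :=
  ⟨J₅ F * kᵀ * J₅ F, mul_mem_K (mul_mem_K J₅_mem_K ⟨transpose_mem_G hk.1, fun i j => hk.2 j i⟩)
    J₅_mem_K, J₅_mul_transpose_mul_J₅_mul hk.1⟩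

theorem norm_mulVec (hk : k ∈ K F) (v : Fin 5 → F) : ‖k *ᵥ v‖ = ‖v‖ := by
  have le {g : Matrix (Fin 5) (Fin 5) F} (hg : g ∈ K F) (w : Fin 5 → F) : ‖g *ᵥ w‖ ≤ ‖w‖ :=
    norm_mulVec_le (fun i j => mem_R_iff.1 (hg.2 i j)) w
  obtain ⟨k', hk', hkk'⟩ := exists_mem_K_mul_eq_one hk
  refine (le hk v).antisymm ?_
  simpa only [Matrix.mulVec_mulVec, hkk', Matrix.one_mulVec] using le hk' (k *ᵥ v)

theorem mulVec_mem_orbit (hk : k ∈ K F) (hv : v ∈ orbit ϖ i) : k *ᵥ v ∈ orbit ϖ i := by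
  obtain ⟨k', hk', rfl⟩ := hv
  exact ⟨k * k', mul_mem_K hk hk', Matrix.mulVec_mulVec _ _ _⟩

theorem mem_orbit_of_mulVec_mem_orbit (hk : k ∈ K F) (hv : k *ᵥ v ∈ orbit ϖ i) :
    v ∈ orbit ϖ i := by
  obtain ⟨k', hk', hkk'⟩ := exists_mem_K_mul_eq_one hk
  simpa only [Matrix.mulVec_mulVec, hkk', Matrix.one_mulVec] using mulVec_mem_orbit hk' hv

theorem exists_mem_K_norm_mulVec_apply_four (h2 : ‖(2 : F)‖ = 1) (v : Fin 5 → F) :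
    ∃ k ∈ K F, ‖(k *ᵥ v) 4‖ = ‖v‖ := by
  have of_first {w : Fin 5 → F} (hw : ‖w 0‖ = ‖w‖) : ∃ k ∈ K F, ‖(k *ᵥ w) 4‖ = ‖w‖ :=
    ⟨J₅ F, J₅_mem_K, by rw [J₅_mulVec]; exact hw⟩
  have of_mulVec {k : Matrix (Fin 5) (Fin 5) F} (hk : k ∈ K F)
      (h : ‖(k *ᵥ v) 0‖ = ‖v‖) : ∃ k ∈ K F, ‖(k *ᵥ v) 4‖ = ‖v‖ := by
    obtain ⟨k', hk', h'⟩ := of_first (h.trans (norm_mulVec hk v).symm)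
    exact ⟨k' * k, mul_mem_K hk' hk, by rw [← Matrix.mulVec_mulVec, h', norm_mulVec hk]⟩
  by_cases h0 : ‖v 0‖ = ‖v‖
  · exact of_first h0
  by_cases h4 : ‖v 4‖ = ‖v‖
  · have h_one : n 0 0 0 ∈ K F := n_mem_K h2 (by simp) (by simp) (by simp)
    exact ⟨_, h_one, by rw [n_mulVec]; exact h4⟩
  obtain ⟨j, hj⟩ := exists_norm_apply_eq v
  fin_cases j
  · exact absurd hj h0
  · exact of_mulVec weylSwap_mem_K (by rw [weylSwap_mulVec]; exact hj)
  · -- Only `v 2` may be dominant: `n(0, 1, 0)` subtracts it from the first coordinate.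
    refine of_mulVec (n_mem_K h2 (x := 0) (y := 1) (z := 0) (by simp) (by simp) (by simp)) ?_
    have lt {j} (h : ‖v j‖ ≠ ‖v‖) : ‖v j‖ < ‖v 2‖ := hj ▸ (norm_le_pi_norm v j).lt_of_ne h
    have h_rest : ‖v 0 - v 4 / 2‖ < ‖-v 2‖ := by
      rw [norm_neg]
      exact norm_sub_lt_of_norm_lt (lt h0) (by rw [norm_div, h2, div_one]; exact lt h4)
    have h_first : (n 0 1 0 *ᵥ v) 0 = v 0 - v 4 / 2 + -v 2 := by
      simp only [n_mulVec, Matrix.cons_val]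
      ring
    rw [h_first, IsUltrametricDist.norm_add_eq_max_of_norm_ne_norm h_rest.ne,
      max_eq_right h_rest.le, norm_neg]
    exact hj
  · refine ⟨weylSwap F, weylSwap_mem_K, by rw [weylSwap_mulVec]; exact hj⟩
  · exact absurd hj h4

theorem mem_orbit_of_norm_apply_four (h2 : ‖(2 : F)‖ = 1) (hv : v ∈ S F) (h4 : ‖v 4‖ = ‖v‖)
    (hnorm : ‖v‖ = ‖(ϖ : F)‖⁻¹ ^ i) : v ∈ orbit ϖ i := by
  have h20 : (2 : F) ≠ 0 := ne_zero_of_norm_ne_zero (h2.symm ▸ one_ne_zero)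
  have hϖ0 : ‖(ϖ : F)‖ ≠ 0 := norm_ne_zero_iff.2 ϖ.ne_zero
  have hv4 : v 4 ≠ 0 := norm_ne_zero_iff.1 (by rw [h4, hnorm]; positivity)
  let c : Fˣ := Units.mk0 (v 4) hv4
  have hc : (c : F) = v 4 := rfl
  have h_ratio (j : Fin 5) : ‖(c : F)⁻¹ * v j‖ ≤ 1 := by
    rw [norm_mul, norm_inv, hc, h4]
    exact inv_mul_le_one_of_le₀ (norm_le_pi_norm v j) (norm_nonneg v)
  have h_unit : ‖((c⁻¹ * (ϖ ^ i)⁻¹ : Fˣ) : F)‖ = 1 := by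
    simp only [Units.val_mul, Units.val_inv_eq_inv_val, Units.val_pow_eq_pow_val, norm_mul,
      norm_inv, norm_pow, hc, h4, hnorm, inv_pow, inv_inv]
    exact mul_inv_cancel₀ (pow_ne_zero i hϖ0)
  refine ⟨n ((c : F)⁻¹ * v 1) ((c : F)⁻¹ * v 2) ((c : F)⁻¹ * v 3) * a (c⁻¹ * (ϖ ^ i)⁻¹),
    mul_mem_K (n_mem_K h2 (h_ratio 1) (h_ratio 2) (h_ratio 3)) (a_mem_K h_unit), ?_⟩
  rw [← Matrix.mulVec_mulVec, Matrix.mulVec_mulVec (v₁ F), a_mul_a, inv_mul_cancel_right,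
    n_mulVec_a_mulVec_v₁]
  rw [mem_S_iff] at hv
  ext j
  fin_cases j
  · simp only [Units.val_inv_eq_inv_val, hc, inv_inv, Matrix.cons_val, Fin.zero_eta]
    field_simp
    linear_combination hv
  all_goals simp [hc, hv4]

theorem mem_orbit_iff (h2 : ‖(2 : F)‖ = 1) (hϖ : ‖(ϖ : F)‖ ≤ 1) :
    v ∈ orbit ϖ i ↔ v ∈ S F ∧ ‖v‖ = ‖(ϖ : F)‖⁻¹ ^ i := by
  constructor
  · rintro ⟨k, hk, rfl⟩
    have h_norm_pow : ‖((ϖ ^ i : Fˣ) : F)‖ = ‖(ϖ : F)‖ ^ i := by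
      rw [Units.val_pow_eq_pow_val, norm_pow]
    refine ⟨(mulVec_mem_S_iff hk.1).2 ((mulVec_mem_S_iff (a_mem_G _)).2 (v₁_mem_S
      (ne_zero_of_norm_ne_zero (h2.symm ▸ one_ne_zero)))), ?_⟩
    rw [norm_mulVec hk, norm_a_mulVec_v₁ h2 (h_norm_pow ▸ pow_le_one₀ (norm_nonneg _) hϖ),
      h_norm_pow, inv_pow]
  · rintro ⟨hv, hnorm⟩
    obtain ⟨k, hk, h4⟩ := exists_mem_K_norm_mulVec_apply_four h2 v
    rw [← norm_mulVec hk] at h4 hnorm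
    exact mem_orbit_of_mulVec_mem_orbit hk
      (mem_orbit_of_norm_apply_four h2 ((mulVec_mem_S_iff hk.1).2 hv) h4 hnorm)

theorem one_le_norm_of_mem_S (hv : v ∈ S F) : 1 ≤ ‖v‖ := by
  have h : ‖v ⬝ᵥ (J₅ F *ᵥ v)‖ ≤ ‖v‖ * ‖J₅ F *ᵥ v‖ := norm_dotProduct_le _ _
  rw [show v ⬝ᵥ (J₅ F *ᵥ v) = 1 from hv, norm_one, norm_mulVec J₅_mem_K] at h
  exact (one_le_sq_iff₀ (norm_nonneg v)).1 (by rwa [sq])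

theorem IsUniformizer.exists_norm_eq_pow (hϖ : IsUniformizer ϖ) (hv : 1 ≤ ‖v‖) :
    ∃ i : ℕ, ‖v‖ = ‖(ϖ : F)‖⁻¹ ^ i := by
  obtain ⟨j, hj⟩ := exists_norm_apply_eq v
  obtain ⟨k, hk⟩ := hϖ.exists_norm_eq_zpow (norm_pos_iff.1 (hj ▸ zero_lt_one.trans_le hv))
  rw [hj, ← neg_neg k, ← inv_zpow'] at hk
  have hk0 : 0 ≤ -k := (one_le_zpow_iff_right₀ hϖ.one_lt_inv_norm).1 (hk ▸ hv)
  lift -k to ℕ using hk0 with i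
  exact ⟨i, by rw [hk, zpow_natCast]⟩

theorem Φ_eq_indicator (h2 : ‖(2 : F)‖ = 1) (hϖ : IsUniformizer ϖ) (r : ℕ) :
    Φ ϖ r = {v : Fin 5 → F | v ∈ S F ∧ ∀ i, ‖v i‖ ≤ ‖(ϖ : F)‖⁻¹ ^ r}.indicator
      (fun _ => (1 : ℂ)) := by
  classical
  funext v
  have h_ball : (∀ i, ‖v i‖ ≤ ‖(ϖ : F)‖⁻¹ ^ r) ↔ ‖v‖ ≤ ‖(ϖ : F)‖⁻¹ ^ r :=
    (pi_norm_le_iff_of_nonneg (by positivity)).symm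
  simp only [Φ, Set.indicator_apply, Set.mem_ofPred_eq, mem_orbit_iff h2 hϖ.norm_lt_one.le, h_ball]
  by_cases hv : v ∈ S F
  · obtain ⟨i, hi⟩ := hϖ.exists_norm_eq_pow (one_le_norm_of_mem_S hv)
    have h1 := hϖ.one_lt_inv_norm
    simp only [hv, true_and, hi, pow_right_inj₀ (zero_lt_one.trans h1) h1.ne',
      pow_le_pow_iff_right₀ h1, Finset.sum_ite_eq, Finset.mem_range, Nat.lt_succ_iff]
  · simp [hv]

end IntegralGroup

theorem setIntegral_eq_zero_of_comp_eq_mul {E : Type*} [MeasurableSpace E] {μ : Measure E}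
    {T : E → E} (hT : MeasurePreserving T μ μ) {s : Set E} (hs : MeasurableSet s)
    (hTs : T ⁻¹' s = s) {f : E → ℂ} {c : ℂ} (hc : c ≠ 1) (h : ∀ x, f (T x) = c * f x) :
    ∫ x in s, f x ∂μ = 0 := by
  by_cases hf : AEStronglyMeasurable f (μ.restrict s)
  · have hTs' : MeasurePreserving T (μ.restrict s) (μ.restrict s) := by
      simpa only [hTs] using hT.restrict_preimage hs
    have h_eq : ∫ x in s, f x ∂μ = c * ∫ x in s, f x ∂μ := by
      conv_lhs => rw [← hTs'.map_eq]
      rw [integral_map hTs'.aemeasurable (hTs'.map_eq.symm ▸ hf), ← integral_const_mul]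
      simp only [h]
    by_contra h_ne
    exact hc (mul_right_cancel₀ h_ne (by rw [one_mul, ← h_eq]))
  · exact integral_non_aestronglyMeasurable hf

section OrbitalSupport

variable {F : Type*} [NontriviallyNormedField F] {A : ℝ} {α t : F} {x : F × F × F}
  {ψ : AddChar F Circle} {ϖ : Fˣ}

/-- The set of all `(x₁, x₂, x₃)` for which the coordinates of `n(x₁, x₂, x₃) a_α v₁` have absolute
value at most `A / |α|`, with the common denominator `α` cleared. The condition `1 ≤ A` comes from
the last coordinate `α⁻¹`. -/
def orbitalSupport (α : F) (A : ℝ) : Set (F × F × F) :=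
  {x | 1 ≤ A ∧ ‖x.1‖ ≤ A ∧ ‖x.2.1‖ ≤ A ∧ ‖x.2.2‖ ≤ A ∧
    ‖α ^ 2 - (2 * x.1 * x.2.2 + x.2.1 ^ 2)‖ ≤ A}

theorem orbitalSupport_eq_empty (hA : ¬1 ≤ A) : orbitalSupport α A = ∅ :=
  Set.eq_empty_of_forall_notMem fun _ hx => hA hx.1

theorem isCompact_orbitalSupport [ProperSpace F] (α : F) (A : ℝ) :
    IsCompact (orbitalSupport α A) := by
  refine (isCompact_closedBall (0 : F × F × F) A).of_isClosed_subset ?_ fun x hx => ?_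
  · simp only [orbitalSupport, Set.ofPred_and]
    repeat' first | apply IsClosed.inter | exact isClosed_le (by fun_prop) (by fun_prop)
  · rw [mem_closedBall_zero_iff]
    exact max_le hx.2.1 (max_le hx.2.2.1 hx.2.2.2.1)

theorem forall_norm_apply_le_iff (h2 : ‖(2 : F)‖ = 1) {α : Fˣ} {B : ℝ} :
    (∀ i, ‖(n x.1 x.2.1 x.2.2 *ᵥ (a α *ᵥ v₁ F)) i‖ ≤ B) ↔
      x ∈ orbitalSupport (α : F) (B * ‖(α : F)‖) := by
  have h20 : (2 : F) ≠ 0 := ne_zero_of_norm_ne_zero (h2.symm ▸ one_ne_zero)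
  have hα := α.ne_zero
  have h_scale (y : F) : ‖(α : F)⁻¹ * y‖ ≤ B ↔ ‖y‖ ≤ B * ‖(α : F)‖ := by
    rw [norm_mul, norm_inv, inv_mul_le_iff₀ (norm_pos_iff.2 hα), mul_comm]
  have h_last : ‖(α : F)⁻¹‖ ≤ B ↔ 1 ≤ B * ‖(α : F)‖ := by
    rw [← mul_one (α : F)⁻¹, h_scale, norm_one]
  have h_first : (α : F) / 2 - (α : F)⁻¹ * (x.1 * x.2.2 + x.2.1 ^ 2 / 2) =
      (α : F)⁻¹ * (((α : F) ^ 2 - (2 * x.1 * x.2.2 + x.2.1 ^ 2)) / 2) := by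
    field_simp
  have h_halve (y : F) : ‖y / 2‖ = ‖y‖ := by rw [norm_div, h2, div_one]
  rw [n_mulVec_a_mulVec_v₁, h_first, Fin.forall_fin_succ]
  simp only [Fin.forall_fin_succ, Matrix.cons_val_zero, Matrix.cons_val_succ,
    Matrix.cons_val_fin_one, h_scale, h_halve, h_last, forall_const, orbitalSupport,
    Set.mem_ofPred_eq]
  tauto

theorem orbitalIntegrand_Φ [IsUltrametricDist F] (h2 : ‖(2 : F)‖ = 1) (hϖ : IsUniformizer ϖ)
    (ψ : AddChar F Circle) (r : ℕ) (α : Fˣ) :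
    orbitalIntegrand ψ (Φ ϖ r) α =
      (orbitalSupport (α : F) (‖(ϖ : F)‖⁻¹ ^ r * ‖(α : F)‖)).indicator
        fun x => (ψ x.2.1 : ℂ) := by
  classical
  have h20 : (2 : F) ≠ 0 := ne_zero_of_norm_ne_zero (h2.symm ▸ one_ne_zero)
  funext x
  have hS : n x.1 x.2.1 x.2.2 *ᵥ (a α *ᵥ v₁ F) ∈ S F :=
    (mulVec_mem_S_iff (n_mem_G h20 _ _ _)).2 ((mulVec_mem_S_iff (a_mem_G α)).2 (v₁_mem_S h20))
  rw [orbitalIntegrand, γ₀_mulVec_v₀, Φ_eq_indicator h2 hϖ]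
  simp only [Set.indicator_apply, Set.mem_ofPred_eq, hS, true_and, forall_norm_apply_le_iff h2,
    ite_mul, one_mul, zero_mul]

theorem integrableOn_orbitalSupport [ProperSpace F] [MeasurableSpace F] [BorelSpace F]
    (μ : Measure F) [μ.IsAddHaarMeasure] (hψ : Continuous ψ) (α : F) (A : ℝ) :
    IntegrableOn (fun x => (ψ x.2.1 : ℂ)) (orbitalSupport α A) (μ.prod (μ.prod μ)) :=
  ContinuousOn.integrableOn_compact (isCompact_orbitalSupport α A) (by fun_prop)

theorem integrable_orbitalIntegrand_Φ [IsUltrametricDist F] [ProperSpace F] [MeasurableSpace F]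
    [BorelSpace F] (h2 : ‖(2 : F)‖ = 1) (hϖ : IsUniformizer ϖ) (μ : Measure F)
    [μ.IsAddHaarMeasure] (hψ : Continuous ψ) (r : ℕ) (α : Fˣ) :
    Integrable (orbitalIntegrand ψ (Φ ϖ r) α) (μ.prod (μ.prod μ)) := by
  rw [orbitalIntegrand_Φ h2 hϖ,
    integrable_indicator_iff (isCompact_orbitalSupport _ _).measurableSet]
  exact integrableOn_orbitalSupport μ hψ _ _

theorem Ψ_Φ_eq_setIntegral [IsUltrametricDist F] [ProperSpace F] [MeasurableSpace F] [BorelSpace F]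
    (h2 : ‖(2 : F)‖ = 1) (hϖ : IsUniformizer ϖ) (μ : Measure F) (ψ : AddChar F Circle) (r : ℕ)
    (α : Fˣ) :
    Ψ μ ψ (Φ ϖ r) α = ∫ x in orbitalSupport (α : F) (‖(ϖ : F)‖⁻¹ ^ r * ‖(α : F)‖),
      (ψ x.2.1 : ℂ) ∂(μ.prod (μ.prod μ)) := by
  rw [Ψ, orbitalIntegrand_Φ h2 hϖ, integral_indicator (isCompact_orbitalSupport _ _).measurableSet]

/-- A unipotent transformation that moves `x₂` by `t` and preserves the quadratic form
`2 x₁ x₃ + x₂²` where `x₁ ≠ 0`. (On `x₁ = 0`, where the quotient is `0`, it moves `x₂` only.) -/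
def shear (t : F) (x : F × F × F) : F × F × F :=
  (x.1, x.2.1 + t, x.2.2 - (2 * x.2.1 * t + t ^ 2) / (2 * x.1))

theorem shear_neg_shear (t : F) (x : F × F × F) : shear (-t) (shear t x) = x := by
  ext <;> simp only [shear, add_neg_cancel_right]
  ring

theorem measurePreserving_shear [ProperSpace F] [MeasurableSpace F] [BorelSpace F]
    (μ : Measure F) [μ.IsAddHaarMeasure] (t : F) :
    MeasurePreserving (shear t) (μ.prod (μ.prod μ)) (μ.prod (μ.prod μ)) := by
  refine (MeasurePreserving.id μ).skew_product
    (g := fun x₁ (p : F × F) => (p.1 + t, p.2 - (2 * p.1 * t + t ^ 2) / (2 * x₁)))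
    (by fun_prop) (.of_forall fun x₁ => ?_)
  exact ((measurePreserving_add_right μ t).skew_product
    (g := fun x₂ x₃ => x₃ - (2 * x₂ * t + t ^ 2) / (2 * x₁)) (by fun_prop)
    (.of_forall fun x₂ => (measurePreserving_sub_right μ _).map_eq)).map_eq

end OrbitalSupport

section SupportVanishing

variable {F : Type*} [NontriviallyNormedField F] [IsUltrametricDist F] {A : ℝ} {α b t : F}
  {x : F × F × F} {ψ : AddChar F Circle} {ϖ : Fˣ}

theorem shear_mem_orbitalSupport (h2 : ‖(2 : F)‖ = 1) (ht : ‖t‖ ≤ A)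
    (hx : x ∈ orbitalSupport α A) (hx₁ : ‖x.1‖ = A) : shear t x ∈ orbitalSupport α A := by
  obtain ⟨hA, h₁, h₂, h₃, h_form⟩ := hx
  have hA0 : 0 < A := zero_lt_one.trans_le hA
  have hx₁0 : x.1 ≠ 0 := norm_ne_zero_iff.1 (hx₁ ▸ hA0.ne')
  have h20 : (2 : F) ≠ 0 := ne_zero_of_norm_ne_zero (h2.symm ▸ one_ne_zero)
  have h_num : ‖2 * x.2.1 * t + t ^ 2‖ ≤ A * A := by
    refine norm_add_le_of_norm_le ?_ ?_
    · rw [norm_mul, norm_mul, h2, one_mul]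
      gcongr
    · rw [norm_pow, sq]
      gcongr
  refine ⟨hA, h₁, norm_add_le_of_norm_le h₂ ht, norm_sub_le_of_norm_le h₃ ?_, ?_⟩
  · rwa [norm_div, norm_mul, h2, hx₁, one_mul, div_le_iff₀ hA0]
  · convert h_form using 3
    simp only [shear]
    field_simp
    ring

theorem norm_apply_lt_of_mem_orbitalSupport (h2 : ‖(2 : F)‖ = 1) (hα : ‖α‖ < A) (hA : 1 < A)
    (hx : x ∈ orbitalSupport α A) (hx₁ : ‖x.1‖ < A) : ‖x.2.1‖ < A := by
  obtain ⟨-, -, -, h₃, h_form⟩ := hx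
  have hA0 : 0 < A := zero_lt_one.trans hA
  refine lt_of_pow_lt_pow_left₀ 2 hA0.le ?_
  rw [← norm_pow, show x.2.1 ^ 2 = α ^ 2 - 2 * x.1 * x.2.2 -
    (α ^ 2 - (2 * x.1 * x.2.2 + x.2.1 ^ 2)) by ring]
  refine norm_sub_lt_of_norm_lt (norm_sub_lt_of_norm_lt ?_ ?_) (h_form.trans_lt ?_)
  · rw [norm_pow]
    gcongr
  · rw [norm_mul, norm_mul, h2, one_mul, sq]
    exact (mul_le_mul_of_nonneg_left h₃ (norm_nonneg _)).trans_lt (mul_lt_mul_of_pos_right hx₁ hA0)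
  · exact lt_self_pow₀ hA one_lt_two

theorem add_mem_orbitalSupport (h2 : ‖(2 : F)‖ = 1) (hϖ : IsUniformizer ϖ)
    (hb : ‖(ϖ : F)‖⁻¹ ^ 2 ≤ ‖b‖) (hα : ‖α‖ < ‖b‖) (ht : ‖t‖ ≤ ‖(ϖ : F)‖⁻¹)
    (hx : x ∈ orbitalSupport α ‖b‖) (hx₁ : ‖x.1‖ < ‖b‖) :
    (x.1, x.2.1 + t, x.2.2) ∈ orbitalSupport α ‖b‖ := by
  have h1 := hϖ.one_lt_inv_norm
  have hϖ0 : 0 < ‖(ϖ : F)‖ := norm_pos_iff.2 ϖ.ne_zero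
  have hϖb : ‖(ϖ : F)‖⁻¹ < ‖b‖ := (lt_self_pow₀ h1 one_lt_two).trans_le hb
  have hx₂ := hϖ.norm_le_mul_of_norm_lt
    (norm_apply_lt_of_mem_orbitalSupport h2 hα (h1.trans hϖb) hx hx₁)
  obtain ⟨hA, h₁, h₂, h₃, h_form⟩ := hx
  have h_cross : ‖2 * x.2.1 * t‖ ≤ ‖b‖ := by
    calc ‖2 * x.2.1 * t‖ = ‖x.2.1‖ * ‖t‖ := by rw [norm_mul, norm_mul, h2, one_mul]
      _ ≤ ‖(ϖ : F)‖ * ‖b‖ * ‖(ϖ : F)‖⁻¹ := by gcongr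
      _ = ‖b‖ := by field_simp
  have h_sq : ‖t ^ 2‖ ≤ ‖b‖ := by
    rw [norm_pow]
    exact (pow_le_pow_left₀ (norm_nonneg t) ht 2).trans hb
  refine ⟨hA, h₁, norm_add_le_of_norm_le h₂ (ht.trans hϖb.le), h₃, ?_⟩
  refine (congrArg norm ?_).trans_le
    (norm_sub_le_of_norm_le h_form (norm_add_le_of_norm_le h_cross h_sq))
  ring

variable [ProperSpace F] [MeasurableSpace F] [BorelSpace F] (μ : Measure F) [μ.IsAddHaarMeasure]

theorem setIntegral_shell_eq_zero (h2 : ‖(2 : F)‖ = 1) (ht : ‖t‖ ≤ A) (hψt : ψ t ≠ 1) (α : F) :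
    ∫ x in orbitalSupport α A ∩ {x | ‖x.1‖ = A}, (ψ x.2.1 : ℂ) ∂(μ.prod (μ.prod μ)) = 0 := by
  have maps {t : F} (ht : ‖t‖ ≤ A) {x : F × F × F}
      (hx : x ∈ orbitalSupport α A ∩ {x | ‖x.1‖ = A}) :
      shear t x ∈ orbitalSupport α A ∩ {x | ‖x.1‖ = A} :=
    ⟨shear_mem_orbitalSupport h2 ht hx.1 hx.2, hx.2⟩
  refine setIntegral_eq_zero_of_comp_eq_mul (c := ψ t) (measurePreserving_shear μ t)
    ((isCompact_orbitalSupport α A).measurableSet.inter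
      (measurableSet_eq_fun (by fun_prop) (by fun_prop)))
    (Set.ext fun x => ⟨fun hx => ?_, maps ht⟩) (Circle.coe_eq_one.not.2 hψt) fun x => ?_
  · rw [← shear_neg_shear t x]
    exact maps (by rwa [norm_neg]) hx
  · rw [← Circle.coe_mul, ← AddChar.map_add_eq_mul, add_comm t]
    rfl

theorem setIntegral_orbitalSupport_eq_setIntegral_inter (h2 : ‖(2 : F)‖ = 1) (hψ : Continuous ψ)
    (ht : ‖t‖ ≤ A) (hψt : ψ t ≠ 1) (α : F) :
    ∫ x in orbitalSupport α A, (ψ x.2.1 : ℂ) ∂(μ.prod (μ.prod μ)) =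
      ∫ x in orbitalSupport α A ∩ {x | ‖x.1‖ < A}, (ψ x.2.1 : ℂ) ∂(μ.prod (μ.prod μ)) := by
  have h_diff : orbitalSupport α A \ {x | ‖x.1‖ < A} = orbitalSupport α A ∩ {x | ‖x.1‖ = A} := by
    ext x
    exact and_congr_right fun hx => not_lt.trans hx.2.1.ge_iff_eq
  rw [← integral_inter_add_sdiff (measurableSet_lt (by fun_prop) (by fun_prop) :
      MeasurableSet {x : F × F × F | ‖x.1‖ < A}) (integrableOn_orbitalSupport μ hψ α A), h_diff,
    setIntegral_shell_eq_zero μ h2 ht hψt, add_zero]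

theorem setIntegral_core_eq_zero (h2 : ‖(2 : F)‖ = 1) (hϖ : IsUniformizer ϖ)
    (hb : ‖(ϖ : F)‖⁻¹ ^ 2 ≤ ‖b‖) (hα : ‖α‖ < ‖b‖) (ht : ‖t‖ ≤ ‖(ϖ : F)‖⁻¹) (hψt : ψ t ≠ 1) :
    ∫ x in orbitalSupport α ‖b‖ ∩ {x | ‖x.1‖ < ‖b‖}, (ψ x.2.1 : ℂ) ∂(μ.prod (μ.prod μ)) = 0 := by
  have maps {t : F} (ht : ‖t‖ ≤ ‖(ϖ : F)‖⁻¹) {x : F × F × F}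
      (hx : x ∈ orbitalSupport α ‖b‖ ∩ {x | ‖x.1‖ < ‖b‖}) :
      (x.1, x.2.1 + t, x.2.2) ∈ orbitalSupport α ‖b‖ ∩ {x | ‖x.1‖ < ‖b‖} :=
    ⟨add_mem_orbitalSupport h2 hϖ hb hα ht hx.1 hx.2, hx.2⟩
  refine setIntegral_eq_zero_of_comp_eq_mul (c := ψ t)
    ((MeasurePreserving.id μ).prod ((measurePreserving_add_right μ t).prod (.id μ)))
    ((isCompact_orbitalSupport α ‖b‖).measurableSet.inter
      (measurableSet_lt (by fun_prop) (by fun_prop)))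
    (Set.ext fun x => ⟨fun hx => ?_, maps ht⟩) (Circle.coe_eq_one.not.2 hψt) fun x => ?_
  · simpa using maps (t := -t) (by rwa [norm_neg]) hx
  · rw [← Circle.coe_mul, ← AddChar.map_add_eq_mul, add_comm t]
    rfl

end SupportVanishing

section OrbitalIntegralValues

variable {F : Type*} [NontriviallyNormedField F] [IsUltrametricDist F] {α b t : F} {ϖ : Fˣ}

theorem orbitalSupport_one (hα : ‖α‖ ≤ 1) :
    orbitalSupport α 1 =
      Metric.closedBall 0 1 ×ˢ Metric.closedBall 0 1 ×ˢ Metric.closedBall 0 1 := by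
  ext x
  simp only [orbitalSupport, Set.mem_ofPred_eq, Set.mem_prod, mem_closedBall_zero_iff]
  refine ⟨fun ⟨_, h₁, h₂, h₃, _⟩ => ⟨h₁, h₂, h₃⟩, fun ⟨h₁, h₂, h₃⟩ => ⟨le_rfl, h₁, h₂, h₃, ?_⟩⟩
  simp only [← mem_R_iff] at *
  exact sub_mem (pow_mem hα 2) (add_mem (mul_mem (mul_mem (ofNat_mem _ 2) h₁) h₃) (pow_mem h₂ 2))

theorem orbitalSupport_inv_norm_inter (h2 : ‖(2 : F)‖ = 1) (hϖ : IsUniformizer ϖ) (hα : ‖α‖ ≤ 1) :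
    orbitalSupport α ‖(ϖ : F)‖⁻¹ ∩ {x | ‖x.1‖ < ‖(ϖ : F)‖⁻¹} =
      Metric.closedBall 0 1 ×ˢ Metric.closedBall 0 1 ×ˢ Metric.closedBall 0 ‖(ϖ : F)‖⁻¹ := by
  have h1 := hϖ.one_lt_inv_norm
  ext x
  simp only [Set.mem_inter_iff, Set.mem_ofPred_eq, Set.mem_prod, mem_closedBall_zero_iff,
    ← hϖ.norm_lt_inv_norm_iff]
  refine ⟨fun ⟨hx, hx₁⟩ => ⟨hx₁, norm_apply_lt_of_mem_orbitalSupport h2 (hα.trans_lt h1) h1 hx hx₁,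
    hx.2.2.2.1⟩, fun ⟨h₁, h₂, h₃⟩ => ⟨⟨h1.le, h₁.le, h₂.le, h₃, ?_⟩, h₁⟩⟩
  rw [hϖ.norm_lt_inv_norm_iff] at h₁ h₂
  refine norm_sub_le_of_norm_le ?_ (norm_add_le_of_norm_le ?_ ?_)
  · rw [norm_pow]
    exact (pow_le_one₀ (norm_nonneg α) hα).trans h1.le
  · rw [norm_mul, norm_mul, h2, one_mul]
    exact (mul_le_of_le_one_left (norm_nonneg _) h₁).trans h₃
  · rw [norm_pow]
    exact (pow_le_one₀ (norm_nonneg _) h₂).trans h1.le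

variable {ψ : AddChar F Circle}

theorem HasConductorR.exists_norm_le (hψ : HasConductorR ψ ϖ) :
    ∃ t, ‖t‖ ≤ ‖(ϖ : F)‖⁻¹ ∧ ψ t ≠ 1 := by
  obtain ⟨-, x, hx, hψx⟩ := hψ
  refine ⟨_, ?_, hψx⟩
  rw [norm_mul, norm_inv]
  exact mul_le_of_le_one_right (by positivity) (mem_R_iff.1 hx)

variable [ProperSpace F] [MeasurableSpace F] [BorelSpace F] {μ : Measure F} [μ.IsAddHaarMeasure]

theorem setIntegral_closedBall_prod (hμ : μ (Metric.closedBall 0 1) = 1)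
    (hψ : ∀ x ∈ R F, ψ x = 1) (c : ℝ) :
    ∫ x in Metric.closedBall 0 1 ×ˢ Metric.closedBall 0 1 ×ˢ Metric.closedBall 0 c,
      (ψ x.2.1 : ℂ) ∂(μ.prod (μ.prod μ)) = μ.real (Metric.closedBall 0 c) := by
  have h_one : Set.EqOn (fun x : F × F × F => (ψ x.2.1 : ℂ)) (fun _ => 1)
      (Metric.closedBall 0 1 ×ˢ Metric.closedBall 0 1 ×ˢ Metric.closedBall 0 c) := fun x hx => by
    simp only [hψ _ (mem_R_iff.2 (mem_closedBall_zero_iff.1 hx.2.1)), Circle.coe_one]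
  rw [setIntegral_congr_fun (measurableSet_closedBall.prod
      (measurableSet_closedBall.prod measurableSet_closedBall)) h_one, setIntegral_const,
    measureReal_prod_prod, measureReal_prod_prod, measureReal_def μ (Metric.closedBall 0 1), hμ,
    ENNReal.toReal_one, one_mul, one_mul, Complex.real_smul, mul_one]

theorem setIntegral_orbitalSupport_one (hμ : μ (Metric.closedBall 0 1) = 1)
    (hψ : ∀ x ∈ R F, ψ x = 1) (hα : ‖α‖ ≤ 1) :
    ∫ x in orbitalSupport α 1, (ψ x.2.1 : ℂ) ∂(μ.prod (μ.prod μ)) = 1 := by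
  rw [orbitalSupport_one hα, setIntegral_closedBall_prod hμ hψ, measureReal_def, hμ,
    ENNReal.toReal_one, Complex.ofReal_one]

theorem setIntegral_orbitalSupport_inv_norm [Finite (Residue F)] (h2 : ‖(2 : F)‖ = 1)
    (hϖ : IsUniformizer ϖ) (hμ : μ (Metric.closedBall 0 1) = 1) (hψ_cont : Continuous ψ)
    (hψ : HasConductorR ψ ϖ) (hα : ‖α‖ ≤ 1) :
    ∫ x in orbitalSupport α ‖(ϖ : F)‖⁻¹, (ψ x.2.1 : ℂ) ∂(μ.prod (μ.prod μ)) = q F := by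
  obtain ⟨t, ht, hψt⟩ := hψ.exists_norm_le
  rw [setIntegral_orbitalSupport_eq_setIntegral_inter μ h2 hψ_cont ht hψt,
    orbitalSupport_inv_norm_inter h2 hϖ hα, setIntegral_closedBall_prod hμ hψ.1, measureReal_def,
    hϖ.measure_closedBall_inv μ hμ, ENNReal.toReal_natCast, Complex.ofReal_natCast]

theorem setIntegral_orbitalSupport_eq_zero (h2 : ‖(2 : F)‖ = 1) (hϖ : IsUniformizer ϖ)
    (hψ_cont : Continuous ψ) (hψ : HasConductorR ψ ϖ) (hα : ‖α‖ < ‖b‖) (hb : ‖b‖ ≠ 1)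
    (hbϖ : ‖b‖ ≠ ‖(ϖ : F)‖⁻¹) :
    ∫ x in orbitalSupport α ‖b‖, (ψ x.2.1 : ℂ) ∂(μ.prod (μ.prod μ)) = 0 := by
  have hϖ0 : 0 < ‖(ϖ : F)‖ := norm_pos_iff.2 ϖ.ne_zero
  rcases hb.lt_or_gt with hb | hb
  · rw [orbitalSupport_eq_empty hb.not_ge, setIntegral_empty]
  have le_of_norm_lt {x : F} (hx : ‖x‖ < ‖b‖) : ‖(ϖ : F)‖⁻¹ * ‖x‖ ≤ ‖b‖ :=
    (inv_mul_le_iff₀ hϖ0).2 (hϖ.norm_le_mul_of_norm_lt hx)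
  have hϖb : ‖(ϖ : F)‖⁻¹ ≤ ‖b‖ := by simpa using le_of_norm_lt (x := 1) (by rwa [norm_one])
  have hϖb2 : ‖(ϖ : F)‖⁻¹ ^ 2 ≤ ‖b‖ := by
    simpa [sq] using le_of_norm_lt (x := (ϖ : F)⁻¹) (by
      rw [norm_inv]
      exact hϖb.lt_of_ne' hbϖ)
  obtain ⟨t, ht, hψt⟩ := hψ.exists_norm_le
  rw [setIntegral_orbitalSupport_eq_setIntegral_inter μ h2 hψ_cont (ht.trans hϖb) hψt,
    setIntegral_core_eq_zero μ h2 hϖ hϖb2 hα ht hψt]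

end OrbitalIntegralValues

section UnitCoset

variable {F : Type*} [NontriviallyNormedField F]

/-- The coset `β Rˣ` of the group of units of `R`, described by the absolute value. -/
def unitCoset (β : Fˣ) : Set Fˣ := {u | ‖(u : F)‖ = ‖(β : F)‖}

theorem mem_unitCoset_pow_iff {α ϖ : Fˣ} {k : ℕ} :
    α ∈ unitCoset (ϖ ^ k) ↔ ‖(α : F)‖ = ‖(ϖ : F)‖ ^ k := by
  rw [unitCoset, Set.mem_ofPred_eq, Units.val_pow_eq_pow_val, norm_pow]

theorem isCompact_unitCoset [ProperSpace F] (β : Fˣ) : IsCompact (unitCoset β) := by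
  have h_image : Units.val '' unitCoset β = Metric.sphere (0 : F) ‖(β : F)‖ := by
    ext x
    rw [mem_sphere_zero_iff_norm]
    refine ⟨fun ⟨_, hu, hux⟩ => hux ▸ hu, fun hx => ?_⟩
    exact ⟨Units.mk0 x (norm_ne_zero_iff.1 (hx ▸ norm_ne_zero_iff.2 β.ne_zero)), hx, rfl⟩
  rw [Units.isEmbedding_val₀.isCompact_iff, h_image]
  exact isCompact_sphere _ _

variable [MeasurableSpace F] [BorelSpace F]

instance borelSpace_units : BorelSpace Fˣ := by
  refine ⟨?_⟩
  rw [Units.isEmbedding_val₀.eq_induced, borel_comap, ← BorelSpace.measurable_eq (α := F)]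
  rfl

theorem measurableSet_unitCoset (β : Fˣ) : MeasurableSet (unitCoset β) :=
  (isClosed_eq Units.continuous_val.norm continuous_const).measurableSet

variable {ν : Measure Fˣ} [ν.IsHaarMeasure]

theorem integrable_indicator_unitCoset [ProperSpace F] {f : Fˣ → ℂ} (hf : Continuous f)
    (β : Fˣ) :
    Integrable ((unitCoset β).indicator f) ν :=
  (hf.continuousOn.integrableOn_compact (isCompact_unitCoset β)).integrable_indicator
    (measurableSet_unitCoset β)

theorem measure_unitCoset (hν : ν {u : Fˣ | ‖(u : F)‖ = 1} = 1) (β : Fˣ) :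
    ν (unitCoset β) = 1 := by
  have h_preimage : unitCoset β = (β⁻¹ * ·) ⁻¹' {u : Fˣ | ‖(u : F)‖ = 1} := by
    ext u
    rw [Set.mem_preimage, Set.mem_ofPred_eq, Units.val_mul, Units.val_inv_eq_inv_val, norm_mul,
      norm_inv, inv_mul_eq_one₀ (norm_ne_zero_iff.2 β.ne_zero), eq_comm]
    rfl
  rw [h_preimage, measure_preimage_mul, hν]

variable {χ : Fˣ →* ℂˣ}

theorem setIntegral_unitCoset_of_isUnramified (hν : ν {u : Fˣ | ‖(u : F)‖ = 1} = 1)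
    (hχ : IsUnramified χ) (β : Fˣ) : ∫ α in unitCoset β, (χ α : ℂ) ∂ν = χ β := by
  have h_const : Set.EqOn (fun α => (χ α : ℂ)) (fun _ => (χ β : ℂ)) (unitCoset β) := by
    intro α hα
    have h := hχ (α / β) (by
      rw [Units.val_div_eq_div_val, norm_div, show ‖(α : F)‖ = _ from hα,
        div_self (norm_ne_zero_iff.2 β.ne_zero)])
    rw [map_div, div_eq_one] at h
    exact congrArg Units.val h
  rw [setIntegral_congr_fun (measurableSet_unitCoset β) h_const, setIntegral_const, measureReal_def,
    measure_unitCoset hν, ENNReal.toReal_one, one_smul]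

theorem setIntegral_unitCoset_of_not_isUnramified (hχ : ¬IsUnramified χ) (β : Fˣ) :
    ∫ α in unitCoset β, (χ α : ℂ) ∂ν = 0 := by
  obtain ⟨u, hu, hχu⟩ : ∃ u : Fˣ, ‖(u : F)‖ = 1 ∧ χ u ≠ 1 := by
    simpa only [IsUnramified, not_forall, exists_prop] using hχ
  refine setIntegral_eq_zero_of_comp_eq_mul (c := χ u) (measurePreserving_mul_left ν u)
    (measurableSet_unitCoset β) (Set.ext fun α => ?_) (Units.val_eq_one.not.2 hχu) fun α => ?_
  · simp only [unitCoset, Set.mem_preimage, Set.mem_ofPred_eq, Units.val_mul, norm_mul, hu, one_mul]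
  · rw [map_mul, Units.val_mul]

end UnitCoset

section Mellin

variable {F : Type*} [NontriviallyNormedField F] [IsUltrametricDist F] [ProperSpace F]
  [MeasurableSpace F] [BorelSpace F] [Finite (Residue F)] {ϖ : Fˣ} {μ : Measure F}
  [μ.IsAddHaarMeasure] {ψ : AddChar F Circle}

theorem Ψ_Φ_succ (h2 : ‖(2 : F)‖ = 1) (hϖ : IsUniformizer ϖ)
    (hμ : μ (Metric.closedBall 0 1) = 1) (hψ_cont : Continuous ψ) (hψ : HasConductorR ψ ϖ) (s : ℕ) :
    Ψ μ ψ (Φ ϖ (s + 1)) =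
      (unitCoset (ϖ ^ (s + 1))).indicator 1 + (q F : ℂ) • (unitCoset (ϖ ^ s)).indicator 1 := by
  classical
  funext α
  have hϖ0 : ‖(ϖ : F)‖ ≠ 0 := norm_ne_zero_iff.2 ϖ.ne_zero
  have h_scale : ‖((ϖ : F)⁻¹ ^ (s + 1) * α : F)‖ = ‖(ϖ : F)‖⁻¹ ^ (s + 1) * ‖(α : F)‖ := by
    rw [norm_mul, norm_pow, norm_inv]
  have h_first : α ∈ unitCoset (ϖ ^ (s + 1)) ↔ ‖(ϖ : F)‖⁻¹ ^ (s + 1) * ‖(α : F)‖ = 1 := by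
    rw [mem_unitCoset_pow_iff, inv_pow, inv_mul_eq_one₀ (pow_ne_zero _ hϖ0), eq_comm]
  have h_second : α ∈ unitCoset (ϖ ^ s) ↔
      ‖(ϖ : F)‖⁻¹ ^ (s + 1) * ‖(α : F)‖ = ‖(ϖ : F)‖⁻¹ := by
    rw [mem_unitCoset_pow_iff, pow_succ', mul_assoc, mul_eq_left₀ (inv_ne_zero hϖ0), inv_pow,
      inv_mul_eq_one₀ (pow_ne_zero _ hϖ0), eq_comm]
  have norm_le_one {k : ℕ} (hα : α ∈ unitCoset (ϖ ^ k)) : ‖(α : F)‖ ≤ 1 :=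
    mem_unitCoset_pow_iff.1 hα ▸ pow_le_one₀ (norm_nonneg _) hϖ.norm_lt_one.le
  rw [Ψ_Φ_eq_setIntegral h2 hϖ]
  simp only [Pi.add_apply, Pi.smul_apply, Set.indicator_apply, Pi.one_apply]
  by_cases h₁ : α ∈ unitCoset (ϖ ^ (s + 1))
  · have h₂ : α ∉ unitCoset (ϖ ^ s) := by
      rw [h_second, h_first.1 h₁]
      exact hϖ.one_lt_inv_norm.ne
    rw [h_first.1 h₁, setIntegral_orbitalSupport_one hμ hψ.1 (norm_le_one h₁), if_pos h₁,
      if_neg h₂, smul_zero, add_zero]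
  by_cases h₂ : α ∈ unitCoset (ϖ ^ s)
  · rw [h_second.1 h₂, setIntegral_orbitalSupport_inv_norm h2 hϖ hμ hψ_cont hψ (norm_le_one h₂),
      if_neg h₁, if_pos h₂, zero_add, smul_eq_mul, mul_one]
  · rw [if_neg h₁, if_neg h₂, smul_zero, add_zero]
    rw [h_first, ← h_scale] at h₁
    rw [h_second, ← h_scale] at h₂
    rw [← h_scale, setIntegral_orbitalSupport_eq_zero h2 hϖ hψ_cont hψ ?_ h₁ h₂]
    rw [h_scale]
    exact lt_mul_of_one_lt_left (norm_pos_iff.2 α.ne_zero)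
      (one_lt_pow₀ hϖ.one_lt_inv_norm s.succ_ne_zero)

theorem Ψ_Φ_succ_mul (h2 : ‖(2 : F)‖ = 1) (hϖ : IsUniformizer ϖ)
    (hμ : μ (Metric.closedBall 0 1) = 1) (hψ_cont : Continuous ψ) (hψ : HasConductorR ψ ϖ) (s : ℕ)
    (f : Fˣ → ℂ) :
    (fun α => Ψ μ ψ (Φ ϖ (s + 1)) α * f α) = fun α =>
      (unitCoset (ϖ ^ (s + 1))).indicator f α + q F * (unitCoset (ϖ ^ s)).indicator f α := by
  classical
  funext α
  simp only [Ψ_Φ_succ h2 hϖ hμ hψ_cont hψ, Pi.add_apply, Pi.smul_apply, smul_eq_mul,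
    Set.indicator_apply, Pi.one_apply, add_mul, mul_assoc, ite_mul, one_mul, zero_mul]

variable {ν : Measure Fˣ} [ν.IsHaarMeasure] {f : Fˣ → ℂ}

theorem integrable_Ψ_Φ_succ_mul (h2 : ‖(2 : F)‖ = 1) (hϖ : IsUniformizer ϖ)
    (hμ : μ (Metric.closedBall 0 1) = 1) (hψ_cont : Continuous ψ) (hψ : HasConductorR ψ ϖ) (s : ℕ)
    (hf : Continuous f) : Integrable (fun α => Ψ μ ψ (Φ ϖ (s + 1)) α * f α) ν := by
  rw [Ψ_Φ_succ_mul h2 hϖ hμ hψ_cont hψ]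
  exact (integrable_indicator_unitCoset hf _).add
    ((integrable_indicator_unitCoset hf _).const_mul _)

theorem integral_Ψ_Φ_succ_mul (h2 : ‖(2 : F)‖ = 1) (hϖ : IsUniformizer ϖ)
    (hμ : μ (Metric.closedBall 0 1) = 1) (hψ_cont : Continuous ψ) (hψ : HasConductorR ψ ϖ) (s : ℕ)
    (hf : Continuous f) :
    ∫ α, Ψ μ ψ (Φ ϖ (s + 1)) α * f α ∂ν =
      ∫ α in unitCoset (ϖ ^ (s + 1)), f α ∂ν + q F * ∫ α in unitCoset (ϖ ^ s), f α ∂ν := by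
  rw [Ψ_Φ_succ_mul h2 hϖ hμ hψ_cont hψ, integral_add (integrable_indicator_unitCoset hf _)
      ((integrable_indicator_unitCoset hf _).const_mul _), integral_const_mul,
    integral_indicator (measurableSet_unitCoset _), integral_indicator (measurableSet_unitCoset _)]

end Mellin

theorem finite_residue {F : Type*} [NontriviallyNormedField F] [IsUltrametricDist F]
    {ϖ : Fˣ} (h_norm : ‖(ϖ : F)‖ = (q F : ℝ)⁻¹) : Finite (Residue F) :=
  Nat.finite_of_card_ne_zero fun h => norm_ne_zero_iff.2 ϖ.ne_zero <| by
    rw [h_norm, q, h, Nat.cast_zero, inv_zero]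

end OrbitalIntegral

/-- The theorem for the Mellin transform of the orbital integral of `Φ_r` in the split case. The Haar
measures `μ` on `F` and `ν` on `Fˣ` give volume one to `R` and to `Rˣ`. -/
theorem proposition3p5
    {F : Type*} [NontriviallyNormedField F] [IsUltrametricDist F] [ProperSpace F]
    [MeasurableSpace F] [BorelSpace F]
    (h_two : (2 : OrbitalIntegral.Residue F) ≠ 0)
    (ϖ : Fˣ) (hϖ : OrbitalIntegral.IsUniformizer ϖ)
    (h_norm : ‖(ϖ : F)‖ = (OrbitalIntegral.q F : ℝ)⁻¹)
    (μ : Measure F) [μ.IsAddHaarMeasure] (hμ : μ {x : F | ‖x‖ ≤ 1} = 1)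
    (ν : Measure Fˣ) [ν.IsHaarMeasure] (hν : ν {u : Fˣ | ‖(u : F)‖ = 1} = 1)
    (ψ : AddChar F Circle) (hψ_cont : Continuous ψ) (hψ : OrbitalIntegral.HasConductorR ψ ϖ)
    (χ : Fˣ →* ℂˣ) (hχ : Continuous χ)
    (r : ℕ) (hr : 1 ≤ r) :
    OrbitalIntegral.Φ ϖ r =
        {v : Fin 5 → F | v ∈ OrbitalIntegral.S F ∧
          ∀ i, ‖v i‖ ≤ (OrbitalIntegral.q F : ℝ) ^ r}.indicator (fun _ => (1 : ℂ)) ∧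
    (∀ α : Fˣ, Integrable
        (OrbitalIntegral.orbitalIntegrand ψ (OrbitalIntegral.Φ ϖ r) α) (μ.prod (μ.prod μ))) ∧
    Integrable
        (fun α : Fˣ => OrbitalIntegral.Ψ μ ψ (OrbitalIntegral.Φ ϖ r) α * (χ α : ℂ)) ν ∧
    (OrbitalIntegral.IsUnramified χ → ∀ X : ℂ, X = ((χ ϖ : ℂˣ) : ℂ)⁻¹ →
      ∫ α : Fˣ, OrbitalIntegral.Ψ μ ψ (OrbitalIntegral.Φ ϖ r) α * (χ α : ℂ) ∂ν =
        (OrbitalIntegral.q F : ℂ) * X ^ (1 - (r : ℤ)) + X ^ (-(r : ℤ))) ∧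
    (¬ OrbitalIntegral.IsUnramified χ →
      ∫ α : Fˣ, OrbitalIntegral.Ψ μ ψ (OrbitalIntegral.Φ ϖ r) α * (χ α : ℂ) ∂ν = 0) := by
  open OrbitalIntegral in
  have h2 := norm_two h_two
  have : Finite (Residue F) := finite_residue h_norm
  have h_inv : ‖(ϖ : F)‖⁻¹ = q F := by rw [h_norm, inv_inv]
  have hμ' : μ (Metric.closedBall 0 1) = 1 := by simpa only [Metric.closedBall, dist_zero_right]
  have hχ' : Continuous fun α => (χ α : ℂ) := Units.continuous_val.comp hχ
  refine ⟨h_inv ▸ Φ_eq_indicator h2 hϖ r, integrable_orbitalIntegrand_Φ h2 hϖ μ hψ_cont r, ?_⟩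
  obtain ⟨s, rfl⟩ : ∃ s, r = s + 1 := ⟨r - 1, by omega⟩
  refine ⟨integrable_Ψ_Φ_succ_mul h2 hϖ hμ' hψ_cont hψ s hχ', ?_, ?_⟩
  · rintro h_unram X rfl
    rw [integral_Ψ_Φ_succ_mul h2 hϖ hμ' hψ_cont hψ s hχ',
      setIntegral_unitCoset_of_isUnramified hν h_unram,
      setIntegral_unitCoset_of_isUnramified hν h_unram]
    simp only [map_pow, Units.val_pow_eq_pow_val, inv_zpow', add_comm]
    norm_num [← zpow_natCast]
  · intro h_ram
    rw [integral_Ψ_Φ_succ_mul h2 hϖ hμ' hψ_cont hψ s hχ',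
      setIntegral_unitCoset_of_not_isUnramified h_ram,
      setIntegral_unitCoset_of_not_isUnramified h_ram, mul_zero, add_zero]
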